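/- Let $K$ be a number field, let $\mathfrak p$ be (an equivalence class of) a $p$-valuation of $K$ for some prime number $p$, and let $\tau=(e,f)$ be a pair of positive integers. Here, for a field $F$ of characteristic $0$, a $p$-valuation on $F$ is a valuation with valuation ring $\mathcal O$ whose residue field has characteristic $p$ and for which $\mathcal O/p\mathcal O$ is finite; equivalent valuations are identified. For an extension $F/K$ let $\mathcal S_{\mathfrak p}^{\tau}(F)$ be the set of $p$-valuations $\mathfrak P$ of $F$ lying above $\mathfrak p$ (i.e. $\mathcal O_{\mathfrak P}\cap K=\mathcal O_{\mathfrak p}$) whose relative initial ramification $e'$ is at most $e$ and whose relative residue degree $f'$ divides $f$. Here $e'$ is determined by $v_{\mathfrak P}(t)=e'\,v_{\mathfrak P}(\pi)$ for uniformizers (elements of least positive value) $t$ of $\mathfrak p$ and $\pi$ of $\mathfrak P$, and $f'$ is the degree of the residue field of $\mathfrak P$ over that of $\mathfrak p$. Let $$R_{\mathfrak p}^{\tau}(F)=\bigcap_{\mathfrak P\in\mathcal S_{\mathfrak p}^{\tau}(F)}\mathcal O_{\mathfrak P}\subseteq F$$ (so $R_{\mathfrak p}^{\tau}(F)=F$ if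 $\mathcal S_{\mathfrak p}^{\tau}(F)=\emptyset$). An ordered abelian group $G$ is a $\mathbb Z$-group if it has a least positive element $1$ and $G=nG+\{0,1,\dots,n-1\}$ for every integer $n\ge 1$ (equivalently, $G$ is elementarily equivalent to $\mathbb Z$). Let $\mathcal S_{\mathfrak p}^{\tau,\mathbb Z}(F)$ be the set of those $\mathfrak P\in\mathcal S_{\mathfrak p}^{\tau}(F)$ whose value group $v_{\mathfrak P}(F^\times)$ is a $\mathbb Z$-group. Let $\mathcal L_R(K)$ be the language of rings expanded by a unary predicate $R$ and by constants for the elements of $K$. Then there exists an $\mathcal L_R(K)$-theory $T_{\mathbb Z,\mathfrak p}^{\tau}$ such that for every field extension $F/K$, $$(F,R_{\mathfrak p}^{\tau}(F))\models T_{\mathbb Z,\mathfrak p}^{\tau}\quad\Longleftrightarrow\quad \mathcal S_{\mathfrak p}^{\tau}(F)=\mathcal S_{\mathfrak p}^{\tau,\mathbb Z}(F),$$ that is, if and only if every $p$-valuation in $\mathcal S_{\mathfrak p}^{\tau}(F)$ has a $\mathbb Z$-group as value group. -/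

import Mathlib

open FirstOrder FirstOrder.Language

universe u w

/-! ### Ordered abelian groups: `ℤ`-groups -/

/-- An ordered abelian group `G` is a `ℤ`-group if it is discrete, i.e. has a least positive
element `u` (so that `ℤ u` is a convex subgroup isomorphic to `ℤ`), and
`G = n G + {0, u, …, (n - 1) u}` for every positive integer `n`. -/
def IsOrderedZGroup (G : Type*) [AddCommGroup G] [LinearOrder G] [IsOrderedAddMonoid G] : Prop :=
  ∃ u : G, 0 < u ∧ (∀ g : G, 0 < g → u ≤ g) ∧
    ∀ n : ℕ, 0 < n → ∀ g : G, ∃ h : G, ∃ i : ℕ, i < n ∧ g = n • h + i • u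

/-! ### `p`-valuations

Equivalence classes of valuations on a field `F` are identified with the valuation subrings
of `F`. -/

section PValuations

variable {F : Type*} [Field F]

/-- `P` is (the valuation ring of) a `p`-valuation, of arbitrary `p`-rank: `F` has characteristic
zero, the residue field has characteristic `p`, and `𝒪 / p𝒪` is finite. -/
structure IsPValuationAt (p : ℕ) (P : ValuationSubring F) : Prop where
  prime : p.Prime
  charZero : CharZero F
  residueChar : (p : P) ∈ IsLocalRing.maximalIdeal P
  finite : Finite (P ⧸ Ideal.span {(p : P)})

/-- `P` is a `p`-valuation for some prime number `p`. -/
def IsPValuation (P : ValuationSubring F) : Prop := ∃ p : ℕ, IsPValuationAt p P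

/-- `t` is a uniformizer of `P`: an element of least positive value. (Mathlib's valuations are
written multiplicatively, so positive value means `v t < 1`.) -/
def IsUniformizerOf (P : ValuationSubring F) (t : F) : Prop :=
  t ≠ 0 ∧ P.valuation t < 1 ∧ ∀ x : F, P.valuation x < 1 → P.valuation x ≤ P.valuation t

/-- The value group of `P`, written additively and ordered so that the elements of the valuation
ring are those of value `≥ 0`; hence the order dual of Mathlib's multiplicative value group. -/
abbrev AddValueGroup (P : ValuationSubring F) : Type _ := Additive (P.ValueGroupˣ)ᵒᵈ

variable (K : Type*) [Field K] [Algebra K F]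

/-- The restriction of `P` to the subfield `K`. -/
abbrev restrictTo (P : ValuationSubring F) : ValuationSubring K := P.comap (algebraMap K F)

/-- The inclusion of the valuation ring of the restriction of `P` to `K` in that of `P`. -/
def restrictToHom (P : ValuationSubring F) : restrictTo K P →+* P :=
  ((algebraMap K F).comp (restrictTo K P).subtype).codRestrict P.toSubring fun x => x.2

instance restrictToHom_isLocalHom (P : ValuationSubring F) : IsLocalHom (restrictToHom K P) where
  map_nonunit x hx := by
    obtain ⟨y, hy⟩ := hx.exists_right_inv
    have hy' : algebraMap K F (x : K) * (y : F) = 1 := congrArg Subtype.val hy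
    have hx0 : (x : K) ≠ 0 := by
      intro h
      simp [h] at hy'
    have hinv : algebraMap K F ((x : K)⁻¹) = y := by
      rw [map_inv₀]
      exact (eq_inv_of_mul_eq_one_right hy').symm
    have hmem : ((x : K)⁻¹) ∈ restrictTo K P := by
      rw [ValuationSubring.mem_comap, hinv]
      exact y.2
    exact IsUnit.of_mul_eq_one (⟨_, hmem⟩ : restrictTo K P)
      (Subtype.ext (mul_inv_cancel₀ hx0))

/-- The relative residue degree of `P` over `K`: the degree of the extension of residue
fields. -/
noncomputable def relResidueDegree (P : ValuationSubring F) : ℕ :=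
  letI : Algebra (IsLocalRing.ResidueField (restrictTo K P)) (IsLocalRing.ResidueField P) :=
    (IsLocalRing.ResidueField.map (restrictToHom K P)).toAlgebra
  Module.finrank (IsLocalRing.ResidueField (restrictTo K P)) (IsLocalRing.ResidueField P)

/-- `e'` is the relative initial ramification of `P` over `K`: normalising `v_P` so that
uniformizers of `P` have value `1`, uniformizers of the restriction of `P` to `K` have value
`e'`. -/
def IsRelInitialRamification (P : ValuationSubring F) (e' : ℕ) : Prop :=
  ∃ (t : K) (π : F), IsUniformizerOf (restrictTo K P) t ∧ IsUniformizerOf P π ∧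
    P.valuation (algebraMap K F t) = P.valuation π ^ e'

variable {K}

/-- The set `𝒮_𝔭^τ(F)`, `τ = (e, f)`: the `p`-valuations of `F` lying above `𝔭` with relative
initial ramification at most `e` and relative residue degree dividing `f`. -/
def primesAbove (𝔭 : ValuationSubring K) (e f : ℕ) (F : Type*) [Field F] [Algebra K F] :
    Set (ValuationSubring F) :=
  {P | IsPValuation P ∧ restrictTo K P = 𝔭 ∧
    (∃ e' : ℕ, IsRelInitialRamification K P e' ∧ e' ≤ e) ∧ relResidueDegree K P ∣ f}

/-- The set `𝒮_𝔭^{τ,ℤ}(F)` of those elements of `𝒮_𝔭^τ(F)` whose value group is a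
`ℤ`-group. -/
def primesAboveZ (𝔭 : ValuationSubring K) (e f : ℕ) (F : Type*) [Field F] [Algebra K F] :
    Set (ValuationSubring F) :=
  {P | P ∈ primesAbove 𝔭 e f F ∧ IsOrderedZGroup (AddValueGroup P)}

/-- The holomorphy domain `R_𝔭^τ(F)`: the intersection of the valuation rings of the elements
of `𝒮_𝔭^τ(F)`. -/
def holomorphyDomain (𝔭 : ValuationSubring K) (e f : ℕ) (F : Type*) [Field F] [Algebra K F] :
    Set F :=
  ⋂ P ∈ primesAbove 𝔭 e f F, (P : Set F)

end PValuations

/-! ### The languages `ℒ_R` and `ℒ_R(K)` -/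

/-- The relation symbols of the language with just one unary predicate. -/
inductive UnaryPredRel : ℕ → Type
  | R : UnaryPredRel 1

/-- The language with a single unary predicate symbol `R` and no function symbols. -/
abbrev unaryPredLanguage : FirstOrder.Language.{0, 0} := ⟨fun _ => Empty, UnaryPredRel⟩

/-- `ℒ_R`: the language of rings expanded by a unary predicate `R`. -/
abbrev ringPredLanguage : FirstOrder.Language.{0, 0} := Language.ring.sum unaryPredLanguage

/-- `ℒ_R(K)`: the expansion of `ℒ_R` by constants for the elements of `K`. -/
abbrev ringPredLanguageOver (K : Type u) : FirstOrder.Language.{u, 0} := ringPredLanguage[[K]]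

/-- A subset `S` of `F` as an interpretation of the predicate symbol `R`. -/
@[reducible] def unaryPredStructure {F : Type*} (S : Set F) : unaryPredLanguage.Structure F where
  funMap := fun f => f.elim
  RelMap := fun r => match r with
    | UnaryPredRel.R => fun x => x 0 ∈ S

/-- The `ℒ_R(K)`-structure `(F, S)`, for an extension `F / K` and a subset `S` of `F`. -/
@[reducible] noncomputable def ringPredStructure (K : Type u) {F : Type w} [Field K] [Field F]
    [Algebra K F] (S : Set F) : (ringPredLanguageOver K).Structure F :=
  letI : Language.ring.Structure F := (Ring.compatibleRingOfRing F).toStructure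
  letI : unaryPredLanguage.Structure F := unaryPredStructure S
  letI : (Language.constantsOn K).Structure F := Language.constantsOn.structure (algebraMap K F)
  inferInstance

/-- `(F, S) ⊨ T`, for an `ℒ_R(K)`-theory `T`. -/
def IsModelOf (K : Type u) {F : Type w} [Field K] [Field F] [Algebra K F] (S : Set F)
    (T : (ringPredLanguageOver K).Theory) : Prop :=
  letI : (ringPredLanguageOver K).Structure F := ringPredStructure K S
  F ⊨ T

/-! Write values additively, let `t` be a uniformizer of `𝔭`, and let `R` be the holomorphy domain.
For each N ≥ 1 the axiom says that every x has an approximate N-th root y, with 0 ≤ N v(y) - v(x) ≤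
N v(t) at every `P` in `primesAbove` simultaneously. For x ≠ 0 this means that y^N / x and t^N x /
y^N lie in `R`, so it is first-order over (F, `R`).

The axioms give ℤ-groups (`IsOrderedZGroup.of_approx`): v(t) = e' u with u the least positive value,
so the error lies between 0 and a finite multiple of u. It is then an integer multiple of u, and can
be reduced mod N.

Conversely, ℤ-groups supply an approximate root at each `P` separately, and one y must be found for
all `P`. Two facts make this possible. Compactness: `mem_primesAbove_iff` describes `primesAbove` by
conditions that survive ultrafilter limits, so finitely many candidates suffice
(`exists_finset_cover`). Gluing: all residues are fixed by the q-th power map, where q = |k|^f and k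
is the residue field of `𝔭`, so minima and maxima of values are attained by elements of F, uniformly
in `P` (`valuation_infElement`). Each candidate y is replaced by one of value max(v(y), v(x) - (N-1)
v(y)), which is at least v(x)/N everywhere and unchanged where y is good. The minimum over the
candidates is then good everywhere (`exists_glued_approxRoot`). -/

/-! ### First-order sentences -/

section Sentences

variable {K : Type u} {α : Type*}

/-- The product of two terms of `ℒ_R(K)`. -/
def mulTerm (s t : (ringPredLanguageOver K).Term α) : (ringPredLanguageOver K).Term α :=
  Functions.apply₂ (Sum.inl (Sum.inl Ring.mulFunc) : (ringPredLanguageOver K).Functions 2) s t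

/-- The `n`-th power of a term of `ℒ_R(K)`, multiplied by another term. -/
def powMulTerm (s t : (ringPredLanguageOver K).Term α) : ℕ → (ringPredLanguageOver K).Term α
  | 0 => t
  | n + 1 => mulTerm s (powMulTerm s t n)

/-- The constant of `ℒ_R(K)` naming an element of `K`. -/
def constTerm (c : K) : (ringPredLanguageOver K).Term α :=
  Constants.term ((ringPredLanguage).con c)

/-- The predicate symbol of `ℒ_R(K)`. -/
def predSymbol : (ringPredLanguageOver K).Relations 1 :=
  Sum.inl (Sum.inr UnaryPredRel.R)

/-- The sentence `∀ x ∃ y a b, R(a) ∧ R(b) ∧ a x = y ^ (n + 1) ∧ b y ^ (n + 1) = t ^ (n + 1) x`. -/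
def approxRootSentence (t : K) (n : ℕ) : (ringPredLanguageOver K).Sentence :=
  BoundedFormula.all <| BoundedFormula.ex <| BoundedFormula.ex <| BoundedFormula.ex <|
    (predSymbol.boundedFormula₁ (&2) ⊓ predSymbol.boundedFormula₁ (&3)) ⊓
      (((mulTerm (&2) (&0)).bdEqual (powMulTerm (&1) (&1) n)) ⊓
        ((powMulTerm (&1) (&3) (n + 1)).bdEqual
          (powMulTerm (constTerm t) (&0) (n + 1))))

variable [Field K] {F : Type w} [Field F] [Algebra K F] (S : Set F)

theorem realize_mulTerm (s t : (ringPredLanguageOver K).Term α) (v : α → F) :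
    letI := ringPredStructure K S
    (mulTerm s t).realize v = s.realize v * t.realize v := rfl

theorem realize_powMulTerm (s t : (ringPredLanguageOver K).Term α) (v : α → F) (n : ℕ) :
    letI := ringPredStructure K S
    (powMulTerm s t n).realize v = s.realize v ^ n * t.realize v := by
  induction n with
  | zero => simp [powMulTerm]
  | succ n ih => rw [powMulTerm, realize_mulTerm, ih, pow_succ']; ring

theorem realize_constTerm (c : K) (v : α → F) :
    letI := ringPredStructure K S
    (constTerm c).realize v = algebraMap K F c := rfl

theorem realize_predSymbol {m : ℕ} (s : (ringPredLanguageOver K).Term (α ⊕ Fin m)) (v : α → F)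
    (xs : Fin m → F) :
    letI := ringPredStructure K S
    (predSymbol.boundedFormula₁ s).Realize v xs ↔ s.realize (Sum.elim v xs) ∈ S := Iff.rfl

theorem realize_approxRootSentence (t : K) (n : ℕ) :
    letI := ringPredStructure K S
    F ⊨ approxRootSentence t n ↔ ∀ x : F, ∃ y a b : F, (a ∈ S ∧ b ∈ S) ∧
      a * x = y ^ (n + 1) ∧ y ^ (n + 1) * b = algebraMap K F t ^ (n + 1) * x := by
  let _ := ringPredStructure K S
  simp only [approxRootSentence, Sentence.Realize, Formula.Realize, BoundedFormula.realize_all,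
    BoundedFormula.realize_ex, BoundedFormula.realize_inf, realize_predSymbol,
    BoundedFormula.realize_bdEqual, realize_mulTerm, realize_powMulTerm, realize_constTerm,
    pow_succ]
  rfl

theorem isModelOf_range_approxRootSentence (t : K) :
    IsModelOf K S (Set.range (approxRootSentence t)) ↔ ∀ (n : ℕ) (x : F), ∃ y a b : F,
      (a ∈ S ∧ b ∈ S) ∧ a * x = y ^ (n + 1) ∧
        y ^ (n + 1) * b = algebraMap K F t ^ (n + 1) * x := by
  unfold IsModelOf
  simp only [Theory.model_iff, Set.forall_mem_range, realize_approxRootSentence]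

end Sentences

/-! ### Ordered abelian groups -/

section OrderedGroups

variable {G : Type*} [AddCommGroup G] [LinearOrder G] [IsOrderedAddMonoid G]

theorem exists_eq_nsmul_of_le_nsmul {u : G} (hu : ∀ g : G, 0 < g → u ≤ g) (m : ℕ) :
    ∀ g : G, 0 ≤ g → g ≤ m • u → ∃ j : ℕ, g = j • u := by
  induction m with
  | zero => exact fun g h0 h1 => ⟨0, by simpa using le_antisymm (by simpa using h1) h0⟩
  | succ m ih =>
    intro g h0 h1
    rcases h0.eq_or_lt with rfl | h0
    · exact ⟨0, by simp⟩
    · obtain ⟨j, hj⟩ := ih (g - u) (sub_nonneg.2 (hu g h0))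
        (by rw [sub_le_iff_le_add, ← succ_nsmul]; exact h1)
      exact ⟨j + 1, by rw [succ_nsmul, ← hj, sub_add_cancel]⟩

/-- A discrete group in which every element is `n`-divisible up to a bounded error is
a `ℤ`-group. -/
theorem IsOrderedZGroup.of_approx {u : G} (hu0 : 0 < u) (hu : ∀ g : G, 0 < g → u ≤ g) (m : ℕ)
    (h : ∀ n : ℕ, 0 < n → ∀ g : G, ∃ k : G, 0 ≤ n • k - g ∧ n • k - g ≤ n • m • u) :
    IsOrderedZGroup G := by
  refine ⟨u, hu0, hu, fun n hn g => ?_⟩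
  obtain ⟨k, hk0, hk1⟩ := h n hn g
  rw [← mul_nsmul] at hk1
  obtain ⟨j, hj⟩ := exists_eq_nsmul_of_le_nsmul hu _ _ hk0 hk1
  -- Here g = n k - j u; Euclidean division of -j by n moves the quotient into k and leaves the
  -- remainder i.
  have hdiv : (-(j : ℤ)) = n * (-(j : ℤ) / n) + -(j : ℤ) % n := (Int.mul_ediv_add_emod _ _).symm
  have hn' : (n : ℤ) ≠ 0 := by exact_mod_cast hn.ne'
  obtain ⟨i, hi⟩ := Int.eq_ofNat_of_zero_le (Int.emod_nonneg (-(j : ℤ)) hn')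
  have hlt := Int.emod_lt_of_pos (-(j : ℤ)) (by exact_mod_cast hn : (0 : ℤ) < n)
  generalize -(j : ℤ) / n = c at hdiv
  refine ⟨k + c • u, i, by omega, ?_⟩
  have hg : g = n • k + (-(j : ℤ)) • u := by
    rw [neg_smul, natCast_zsmul, ← hj]; abel
  rw [hg, hdiv, hi, add_smul, smul_add, mul_smul, natCast_zsmul, natCast_zsmul, add_assoc]

/-- In a `ℤ`-group, every element can be approximated from above by multiples of `n`. -/
theorem IsOrderedZGroup.exists_approx (hG : IsOrderedZGroup G) {s : G} (hs : 0 < s) {n : ℕ}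
    (hn : 0 < n) (g : G) : ∃ k : G, 0 ≤ n • k - g ∧ n • k - g ≤ n • s := by
  obtain ⟨u, hu0, hu, h⟩ := hG
  obtain ⟨k, i, hi, rfl⟩ := h n hn g
  have h1 : i • u ≤ n • s := (nsmul_le_nsmul_left hu0.le hi.le).trans
    (nsmul_le_nsmul_right (hu s hs) n)
  have h2 : 0 ≤ i • u := nsmul_nonneg hu0.le i
  -- Shifting k up by s makes the error n s - i u, which is nonnegative because i < n and u ≤ s.
  refine ⟨k + s, ?_, ?_⟩ <;> rw [smul_add]
  · rw [show n • k + n • s - (n • k + i • u) = n • s - i • u by abel]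
    exact sub_nonneg.2 h1
  · rw [show n • k + n • s - (n • k + i • u) = n • s - i • u by abel]
    exact sub_le_self _ h2

/-- If `h : G` and `n h` is near to `g`, replacing `h` by `max h (g - (n - 1) h)` does not change
it; in any case the result is at least `g / n`. -/
theorem nsmul_max_sub_nonneg {n : ℕ} (hn : 0 < n) (g h : G) :
    0 ≤ n • max h (g - (n - 1) • h) - g := by
  obtain ⟨n, rfl⟩ := Nat.exists_eq_succ_of_ne_zero hn.ne'
  simp only [Nat.succ_eq_add_one, Nat.add_sub_cancel, sub_nonneg]
  by_cases hg : g ≤ (n + 1) • h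
  · exact hg.trans (nsmul_le_nsmul_right (le_max_left _ _) _)
  · refine le_trans ?_ (nsmul_le_nsmul_right (le_max_right _ _) _)
    have h1 : 0 ≤ n • (g - (n + 1) • h) := nsmul_nonneg (sub_nonneg.2 (not_le.1 hg).le) n
    have h2 : (n + 1) • (g - n • h) = g + n • (g - (n + 1) • h) := by
      simp only [smul_sub, add_smul, one_smul, smul_add]; abel
    rw [h2]
    exact le_add_of_nonneg_right h1

theorem max_sub_eq_left {n : ℕ} (hn : 0 < n) {g h : G} (hg : 0 ≤ n • h - g) :
    max h (g - (n - 1) • h) = h := by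
  obtain ⟨n, rfl⟩ := Nat.exists_eq_succ_of_ne_zero hn.ne'
  refine max_eq_left ?_
  rw [sub_nonneg, Nat.succ_eq_add_one, succ_nsmul] at hg
  rw [Nat.succ_eq_add_one, Nat.add_sub_cancel, sub_le_iff_le_add, add_comm]
  exact hg

end OrderedGroups

/-! ### Additive valuations -/

section AddVal

variable {F : Type*} [Field F] (P : ValuationSubring F)

/-- The valuation of a valuation ring, written additively, on the nonzero elements. -/
noncomputable def addVal (x : Fˣ) : AddValueGroup P :=
  Additive.ofMul (OrderDual.toDual (Units.map (P.valuation : F →* P.ValueGroup) x))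

theorem addVal_mul (x y : Fˣ) : addVal P (x * y) = addVal P x + addVal P y := by
  simp only [addVal, map_mul]; rfl

theorem addVal_one : addVal P 1 = 0 := by
  simp only [addVal, map_one]; rfl

theorem addVal_inv (x : Fˣ) : addVal P x⁻¹ = -addVal P x := by
  rw [eq_neg_iff_add_eq_zero, ← addVal_mul, inv_mul_cancel, addVal_one]

theorem addVal_div (x y : Fˣ) : addVal P (x / y) = addVal P x - addVal P y := by
  rw [div_eq_mul_inv, addVal_mul, addVal_inv, sub_eq_add_neg]

theorem addVal_pow (x : Fˣ) (n : ℕ) : addVal P (x ^ n) = n • addVal P x := by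
  induction n with
  | zero => simp [addVal_one]
  | succ n ih => rw [pow_succ, addVal_mul, ih, succ_nsmul]

theorem addVal_le_iff (x y : Fˣ) :
    addVal P x ≤ addVal P y ↔ P.valuation (y : F) ≤ P.valuation (x : F) := Iff.rfl

theorem addVal_lt_iff (x y : Fˣ) :
    addVal P x < addVal P y ↔ P.valuation (y : F) < P.valuation (x : F) := by
  rw [← not_le, addVal_le_iff, not_le]

theorem addVal_eq_iff (x y : Fˣ) :
    addVal P x = addVal P y ↔ P.valuation (x : F) = P.valuation (y : F) := by
  rw [le_antisymm_iff, addVal_le_iff, addVal_le_iff, le_antisymm_iff, and_comm]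

theorem addVal_nonneg_iff (x : Fˣ) : 0 ≤ addVal P x ↔ (x : F) ∈ P := by
  rw [← addVal_one, addVal_le_iff, Units.val_one, map_one, P.valuation_le_one_iff]

theorem addVal_pos_iff (x : Fˣ) : 0 < addVal P x ↔ P.valuation (x : F) < 1 := by
  rw [← addVal_one, addVal_lt_iff, Units.val_one, map_one]

theorem addVal_surjective : Function.Surjective (addVal P) := by
  intro g
  obtain ⟨x, hx⟩ := P.valuation_surjective (OrderDual.ofDual g.toMul : P.ValueGroupˣ)
  have hx0 : x ≠ 0 := by
    rintro rfl
    rw [map_zero] at hx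
    exact (OrderDual.ofDual g.toMul).ne_zero hx.symm
  refine ⟨Units.mk0 x hx0, ?_⟩
  have : Units.map (P.valuation : F →* P.ValueGroup) (Units.mk0 x hx0)
      = OrderDual.ofDual g.toMul := Units.ext hx
  rw [addVal, this]
  rfl

end AddVal

/-! ### Elements of minimal value -/

section InfElement

variable {F : Type*} [Field F]

/-- An element whose value is the minimum of the values of `x` and `y`, for every valuation ring
all of whose residues are fixed by the `q`-th power map. -/
noncomputable def infElement (q : ℕ) (x y : F) : F :=
  (x ^ (q + 1) - x ^ 2 * y ^ (q - 1) + y ^ (q + 1)) / (x ^ q - x * y ^ (q - 1) + y ^ q)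

theorem valuation_one_add_eq_one (P : ValuationSubring F) {a : F} (ha : P.valuation a < 1) :
    P.valuation (1 + a) = 1 := by
  rw [add_comm]
  simpa using Valuation.map_add_eq_of_lt_right P.valuation (x := a) (y := 1) (by simpa using ha)

/-- If x = y u with u integral, the quotient is y (1 + u (u^q - u)) / (1 + (u^q - u)); u^q - u is a
nonunit, so both brackets are units. If instead y = x u with u a nonunit, factoring out x again
leaves a quotient of units. In multiplicative notation the additive minimum becomes a maximum. -/
theorem valuation_infElement (P : ValuationSubring F) {q : ℕ} (hq : 2 ≤ q)
    (hP : ∀ u ∈ P, P.valuation (u ^ q - u) < 1) {x y : F} (hx : x ≠ 0) (hy : y ≠ 0) :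
    P.valuation (infElement q x y) = max (P.valuation x) (P.valuation y) := by
  obtain ⟨m, rfl⟩ := Nat.exists_eq_add_of_le' hq
  have hm : m + 2 - 1 = m + 1 := rfl
  have hx' : P.valuation x ≠ 0 := by simpa using hx
  have hy' : P.valuation y ≠ 0 := by simpa using hy
  rcases le_or_gt (P.valuation x) (P.valuation y) with h | h
  · obtain ⟨u, rfl⟩ : ∃ u, x = y * u := ⟨x / y, by field_simp⟩
    have hu : u ∈ P := by
      rw [← P.valuation_le_one_iff]
      rw [map_mul] at h
      exact (mul_le_iff_le_one_right (zero_lt_iff.2 hy')).1 h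
    have h1 := hP u hu
    have h2 : P.valuation (u * (u ^ (m + 2) - u)) < 1 := by
      rw [map_mul]
      exact mul_lt_one_of_nonneg_of_lt_one_right ((P.valuation_le_one_iff u).2 hu) zero_le h1
    have e1 : (y * u) ^ (m + 2 + 1) - (y * u) ^ 2 * y ^ (m + 1) + y ^ (m + 2 + 1)
        = y ^ (m + 3) * (1 + u * (u ^ (m + 2) - u)) := by ring
    have e2 : (y * u) ^ (m + 2) - (y * u) * y ^ (m + 1) + y ^ (m + 2)
        = y ^ (m + 2) * (1 + (u ^ (m + 2) - u)) := by ring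
    rw [infElement, hm, e1, e2, map_div₀, map_mul _ (_ ^ _), map_mul _ (_ ^ _),
      valuation_one_add_eq_one P h1, valuation_one_add_eq_one P h2, max_eq_right h]
    rw [map_pow, map_pow, mul_one, mul_one, pow_succ]
    field_simp
  · obtain ⟨u, rfl⟩ : ∃ u, y = x * u := ⟨y / x, by field_simp⟩
    have hu : P.valuation u < 1 := by
      rw [map_mul] at h
      exact (mul_lt_iff_lt_one_right (zero_lt_iff.2 hx')).1 h
    have key : ∀ v : F, v ∈ P → P.valuation (u * v) < 1 := fun v hv => by
      rw [map_mul]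
      exact mul_lt_one_of_nonneg_of_lt_one_left zero_le hu ((P.valuation_le_one_iff v).2 hv)
    have huP : u ∈ P := (P.valuation_le_one_iff u).1 hu.le
    have h1 := key (u ^ (m + 1) - u ^ m) (sub_mem (pow_mem huP _) (pow_mem huP _))
    have h2 := key (u ^ (m + 2) - u ^ m) (sub_mem (pow_mem huP _) (pow_mem huP _))
    have e1 : x ^ (m + 2 + 1) - x ^ 2 * (x * u) ^ (m + 1) + (x * u) ^ (m + 2 + 1)
        = x ^ (m + 3) * (1 + u * (u ^ (m + 2) - u ^ m)) := by ring
    have e2 : x ^ (m + 2) - x * (x * u) ^ (m + 1) + (x * u) ^ (m + 2)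
        = x ^ (m + 2) * (1 + u * (u ^ (m + 1) - u ^ m)) := by ring
    rw [infElement, hm, e1, e2, map_div₀, map_mul _ (_ ^ _), map_mul _ (_ ^ _),
      valuation_one_add_eq_one P h1, valuation_one_add_eq_one P h2, max_eq_left h.le]
    rw [map_pow, map_pow, mul_one, mul_one, pow_succ]
    field_simp

/-- If the residues of all valuation rings in `S` are fixed by the `q`-th power map, then
the pointwise minimum of two value functions on `S` is a value function. -/
theorem exists_addVal_eq_min (S : Set (ValuationSubring F)) {q : ℕ} (hq : 2 ≤ q)
    (hS : ∀ P ∈ S, ∀ u ∈ P, P.valuation (u ^ q - u) < 1) (x y : Fˣ) :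
    ∃ z : Fˣ, ∀ P ∈ S, addVal P z = min (addVal P x) (addVal P y) := by
  have key : ∀ P ∈ S, P.valuation (infElement q (x : F) y)
      = max (P.valuation (x : F)) (P.valuation (y : F)) :=
    fun P hP => valuation_infElement P hq (hS P hP) x.ne_zero y.ne_zero
  by_cases h0 : infElement q (x : F) y = 0
  -- A zero value contradicts `key` at any member of `S`; so `S` is empty and the witness is
  -- arbitrary.
  · refine ⟨1, fun P hP => absurd (key P hP) ?_⟩
    rw [h0, map_zero]
    exact (lt_max_of_lt_left (by simp [zero_lt_iff])).ne
  · refine ⟨Units.mk0 _ h0, fun P hP => ?_⟩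
    have := key P hP
    rcases le_total (addVal P x) (addVal P y) with h | h
    · rw [min_eq_left h, addVal_eq_iff, Units.val_mk0, this]
      exact max_eq_left ((addVal_le_iff P x y).1 h)
    · rw [min_eq_right h, addVal_eq_iff, Units.val_mk0, this]
      exact max_eq_right ((addVal_le_iff P y x).1 h)

theorem exists_addVal_eq_max (S : Set (ValuationSubring F)) {q : ℕ} (hq : 2 ≤ q)
    (hS : ∀ P ∈ S, ∀ u ∈ P, P.valuation (u ^ q - u) < 1) (x y : Fˣ) :
    ∃ z : Fˣ, ∀ P ∈ S, addVal P z = max (addVal P x) (addVal P y) := by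
  obtain ⟨z, hz⟩ := exists_addVal_eq_min S hq hS x⁻¹ y⁻¹
  refine ⟨z⁻¹, fun P hP => ?_⟩
  rw [addVal_inv, hz P hP, addVal_inv, addVal_inv, min_neg_neg, neg_neg]

/-- Finitely many approximate `n`-th roots (up to values) of `x`, at least one of which is good at
each element of `S`, can be glued to one which is good at every element of `S`. -/
theorem exists_glued_approxRoot (S : Set (ValuationSubring F)) {q : ℕ} (hq : 2 ≤ q)
    (hS : ∀ P ∈ S, ∀ u ∈ P, P.valuation (u ^ q - u) < 1) {n : ℕ} (hn : 0 < n) (x s : Fˣ)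
    (Y : Finset Fˣ) :
    ∃ z : Fˣ, ∀ P ∈ S, 0 ≤ n • addVal P z - addVal P x ∧
      ∀ y ∈ Y, 0 ≤ n • addVal P y - addVal P x →
        n • addVal P y - addVal P x ≤ n • addVal P s →
          n • addVal P z - addVal P x ≤ n • addVal P s := by
  classical
  have hmod : ∀ y : Fˣ, ∃ z : Fˣ, ∀ P ∈ S,
      addVal P z = max (addVal P y) (addVal P x - (n - 1) • addVal P y) := fun y => by
    obtain ⟨z, hz⟩ := exists_addVal_eq_max S hq hS y (x / y ^ (n - 1))
    exact ⟨z, fun P hP => by rw [hz P hP, addVal_div, addVal_pow]⟩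
  induction Y using Finset.induction_on with
  | empty =>
    -- The lower bound is required even without candidates, and the correction provides it for any
    -- starting element.
    obtain ⟨z, hz⟩ := hmod 1
    exact ⟨z, fun P hP => ⟨by rw [hz P hP]; exact nsmul_max_sub_nonneg hn _ _, by simp⟩⟩
  | insert y Y _ ih =>
    obtain ⟨z₁, hz₁⟩ := ih
    obtain ⟨z₂, hz₂⟩ := hmod y
    obtain ⟨z, hz⟩ := exists_addVal_eq_min S hq hS z₁ z₂
    refine ⟨z, fun P hP => ⟨?_, fun y' hy' h0 h1 => ?_⟩⟩
    · rw [hz P hP]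
      rcases min_choice (addVal P z₁) (addVal P z₂) with h | h <;> rw [h]
      · exact (hz₁ P hP).1
      · rw [hz₂ P hP]
        exact nsmul_max_sub_nonneg hn _ _
    · rw [hz P hP]
      rcases Finset.mem_insert.1 hy' with rfl | hy'
      · refine le_trans (sub_le_sub_right (nsmul_le_nsmul_right (min_le_right _ _) n) _) ?_
        rw [hz₂ P hP, max_sub_eq_left hn h0]
        exact h1
      · exact le_trans (sub_le_sub_right (nsmul_le_nsmul_right (min_le_left _ _) n) _)
          ((hz₁ P hP).2 y' hy' h0 h1)

end InfElement

/-! ### Residue degrees -/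

section ResidueDegree

/-- An extension of a finite field `k` has degree dividing `f` if and only if its elements are
fixed by the `f`-th power of the Frobenius map. -/
theorem finrank_dvd_iff_forall_pow_eq (k l : Type*) [Field k] [Field l] [Algebra k l] [Finite k]
    {f : ℕ} (hf : 0 < f) :
    Module.finrank k l ∣ f ↔ ∀ a : l, a ^ Nat.card k ^ f = a := by
  have := Fintype.ofFinite k
  rw [Nat.card_eq_fintype_card]
  have key : ∀ [Finite l], Module.finrank k l ∣ f ↔ ∀ a : l, a ^ Fintype.card k ^ f = a := by
    intro _
    rw [← FiniteField.orderOf_frobeniusAlgHom k l, orderOf_dvd_iff_pow_eq_one, DFunLike.ext_iff]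
    simp_rw [AlgHom.coe_pow, FiniteField.coe_frobeniusAlgHom, pow_iterate, AlgHom.one_apply]
  constructor
  · intro h
    have : Module.Finite k l := Module.finite_of_finrank_pos (Nat.pos_of_dvd_of_pos h hf)
    have : Finite l := Module.finite_of_finite k
    exact key.1 h
  · intro h
    have : Finite l := by
      rw [← Set.finite_univ_iff]
      refine ((Polynomial.X ^ Fintype.card k ^ f - Polynomial.X :
        Polynomial l).rootSet_finite l).subset fun a _ => ?_
      rw [Polynomial.mem_rootSet]
      refine ⟨FiniteField.X_pow_card_sub_X_ne_zero l ?_, by simp [h a]⟩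
      exact Nat.one_lt_pow hf.ne' Fintype.one_lt_card
    exact key.2 h

variable {F : Type*} [Field F] (P : ValuationSubring F)

theorem residue_pow_eq_iff (q : ℕ) :
    (∀ a : IsLocalRing.ResidueField P, a ^ q = a) ↔
      ∀ u ∈ P, P.valuation (u ^ q - u) < 1 := by
  rw [(IsLocalRing.residue_surjective (R := P)).forall, Subtype.forall]
  refine forall₂_congr fun u hu => ?_
  rw [← map_pow, ← sub_eq_zero, ← map_sub, IsLocalRing.residue_eq_zero_iff,
    P.valuation_lt_one_iff]
  rfl

theorem relResidueDegree_dvd_iff (K : Type*) [Field K] [Algebra K F]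
    [Finite (IsLocalRing.ResidueField (restrictTo K P))] {f : ℕ} (hf : 0 < f) :
    relResidueDegree K P ∣ f ↔ ∀ u ∈ P,
      P.valuation (u ^ Nat.card (IsLocalRing.ResidueField (restrictTo K P)) ^ f - u) < 1 := by
  let _ : Algebra (IsLocalRing.ResidueField (restrictTo K P)) (IsLocalRing.ResidueField P) :=
    (IsLocalRing.ResidueField.map (restrictToHom K P)).toAlgebra
  rw [← residue_pow_eq_iff, ← finrank_dvd_iff_forall_pow_eq _ _ hf]
  rfl

end ResidueDegree

/-! ### `p`-valuations -/

section PVal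

variable {F : Type*} [Field F] {P : ValuationSubring F}

theorem IsPValuationAt.finite_residueField {p : ℕ} (hP : IsPValuationAt p P) :
    Finite (IsLocalRing.ResidueField P) := by
  have := hP.finite
  have hle : Ideal.span {(p : P)} ≤ IsLocalRing.maximalIdeal P :=
    (Ideal.span_singleton_le_iff_mem _).2 hP.residueChar
  exact Finite.of_surjective _ (Ideal.Quotient.factor_surjective hle)

/-- The powers of a nonunit are eventually divisible by `p`. -/
theorem IsPValuationAt.exists_pow_dvd {p : ℕ} (hP : IsPValuationAt p P) {t : F}
    (ht : P.valuation t < 1) : ∃ m : ℕ, P.valuation t ^ m ≤ P.valuation (p : F) := by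
  have := hP.finite
  have htP : t ∈ P := (P.valuation_le_one_iff t).1 ht.le
  -- Pigeonhole on powers of t modulo p: if t^i ≡ t^j with i < j, then p divides t^i (1 - t^(j-i)),
  -- whose second factor is a unit.
  obtain ⟨i, j, hij, h⟩ := Finite.exists_ne_map_eq_of_infinite
    fun m : ℕ => Ideal.Quotient.mk (Ideal.span {(p : P)}) (⟨t, htP⟩ ^ m)
  wlog hlt : i < j generalizing i j
  · exact this j i hij.symm h.symm (lt_of_le_of_ne (not_lt.1 hlt) hij.symm)
  obtain ⟨d, rfl⟩ := Nat.exists_eq_add_of_lt hlt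
  rw [Ideal.Quotient.eq, Ideal.mem_span_singleton] at h
  obtain ⟨c, hc⟩ := h
  have hc' : t ^ i * (1 + -t ^ (d + 1)) = (p : F) * c := by
    have := congrArg (Subtype.val) hc
    push_cast at this
    rw [← this]
    ring
  have hv : P.valuation (-t ^ (d + 1)) < 1 := by
    rw [Valuation.map_neg, map_pow]
    exact pow_lt_one₀ zero_le ht (Nat.succ_ne_zero d)
  refine ⟨i, ?_⟩
  have := congrArg P.valuation hc'
  rw [map_mul, map_mul, valuation_one_add_eq_one P hv, mul_one, map_pow] at this
  rw [this]
  exact mul_le_of_le_one_right zero_le (P.valuation_le_one c)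

/-- If the least value `v π` exists, the residue field is finite, and `v p` is at most a multiple of
`v π`, then `P` is a `p`-valuation. -/
theorem IsPValuationAt.of_uniformizer {p : ℕ} (hp : p.Prime) [hF : CharZero F]
    [Finite (IsLocalRing.ResidueField P)] (hp1 : P.valuation (p : F) < 1) {π : F}
    (hπ : IsUniformizerOf P π) {m : ℕ} (hm : P.valuation π ^ m ≤ P.valuation (p : F)) :
    IsPValuationAt p P where
  prime := hp
  charZero := hF
  residueChar := by
    rw [P.valuation_lt_one_iff]
    simpa using hp1
  finite := by
    obtain ⟨hπ0, hπ1, hπ2⟩ := hπ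
    have hπP : π ∈ P := (P.valuation_le_one_iff π).1 hπ1.le
    have hv0 : P.valuation π ≠ 0 := by simpa using hπ0
    have hmax : IsLocalRing.maximalIdeal P = Ideal.span {⟨π, hπP⟩} := by
      refine le_antisymm (fun x hx => ?_) ?_
      · rw [P.valuation_lt_one_iff] at hx
        obtain ⟨a, ha⟩ := (P.valuation_le_iff _ _).1 (hπ2 x hx)
        exact Ideal.mem_span_singleton'.2 ⟨a, Subtype.ext ha⟩
      · rw [Ideal.span_singleton_le_iff_mem, P.valuation_lt_one_iff]
        exact hπ1
    have : Finite (P ⧸ Ideal.span {(⟨π, hπP⟩ : P)}) := by rw [← hmax]; assumption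
    have := Ideal.finite_quotient_pow (Submodule.fg_span_singleton (⟨π, hπP⟩ : P)) m
    have hle : Ideal.span {(⟨π, hπP⟩ : P)} ^ m ≤ Ideal.span {(p : P)} := by
      rw [Ideal.span_singleton_pow, Ideal.span_singleton_le_iff_mem]
      rw [← map_pow] at hm
      obtain ⟨a, ha⟩ := (P.valuation_le_iff _ _).1 hm
      exact Ideal.mem_span_singleton'.2 ⟨a, Subtype.ext (by simpa using ha)⟩
    exact Finite.of_surjective _ (Ideal.Quotient.factor_surjective hle)

/-- If the values of the nonunits are at least `v T / e`, then there is a least positive value, and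
`v T` is at most `e` times that value. -/
theorem exists_isUniformizerOf {T : F} (hT0 : T ≠ 0) (hT1 : P.valuation T < 1) {e : ℕ}
    (hram : ∀ x : F, P.valuation x < 1 → P.valuation x ^ e ≤ P.valuation T) :
    ∃ (k : ℕ) (π : F), k ≤ e ∧ IsUniformizerOf P π ∧ P.valuation T = P.valuation π ^ k := by
  classical
  -- Additively: k v(x) ≤ v(T) for some x of positive value. An x attaining the largest such k will
  -- be the uniformizer.
  let A : ℕ → Prop := fun k => ∃ x : F, P.valuation x < 1 ∧ P.valuation T ≤ P.valuation x ^ k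
  have hT : 0 < P.valuation T := by simpa [zero_lt_iff] using hT0
  have hA : ∀ k, A k → k ≤ e := by
    rintro k ⟨x, hx1, hx⟩
    by_contra! hk
    have h1 : P.valuation x ^ k ≤ P.valuation x ^ (e + 1) :=
      pow_le_pow_right_of_le_one' hx1.le hk
    have h2 : P.valuation x ^ (e + 1) ≤ P.valuation T * P.valuation x := by
      rw [pow_succ]
      exact mul_le_mul_left (hram x hx1) _
    have h3 : P.valuation T * P.valuation x < P.valuation T * 1 :=
      mul_lt_mul_of_pos_left hx1 hT
    rw [mul_one] at h3
    exact absurd (hx.trans (h1.trans h2)) (not_le.2 h3)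
  have hA1 : A 1 := ⟨T, hT1, by simp⟩
  have hgr := Nat.findGreatest_spec (hA 1 hA1) hA1
  have hmax : ∀ k, A k → k ≤ Nat.findGreatest A e := fun k hk =>
    Nat.le_findGreatest (hA k hk) hk
  have hpos : 1 ≤ Nat.findGreatest A e := hmax 1 hA1
  have hle : Nat.findGreatest A e ≤ e := Nat.findGreatest_le e
  generalize Nat.findGreatest A e = k at hgr hmax hpos hle
  obtain ⟨π, hπ1, hπ⟩ := hgr
  have hπ0 : π ≠ 0 := by
    rintro rfl
    rw [map_zero, zero_pow (by omega)] at hπ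
    exact absurd hπ (not_le.2 hT)
  have hv0 : 0 < P.valuation π := by simpa [zero_lt_iff] using hπ0
  -- If 2 v(x) ≤ v(π), then x would witness 2k, against the maximality of k.
  have hsq : ∀ x : F, P.valuation x < 1 → ¬ P.valuation π ≤ P.valuation x ^ 2 := by
    intro x hx1 hx
    have := hmax (2 * k) ⟨x, hx1, by rw [pow_mul]; exact hπ.trans (pow_le_pow_left' hx k)⟩
    omega
  have hunif : ∀ x : F, P.valuation x < 1 → P.valuation x ≤ P.valuation π := by
    intro x hx1
    by_contra! hx
    have hx0 : 0 < P.valuation x := zero_le.trans_lt hx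
    -- If 0 < v(x) < v(π), then `hsq` puts v(x) above half of v(π), so π / x has positive value
    -- below half.
    refine hsq (π / x) ?_ ?_
    · rw [map_div₀]
      exact (div_lt_one₀ hx0).2 hx
    · rw [map_div₀, div_pow, le_div_iff₀ (pow_pos hx0 2), pow_two (P.valuation π)]
      exact mul_le_mul_right (not_le.1 (hsq x hx1)).le _
  refine ⟨k, π, hle, ⟨hπ0, hπ1, hunif⟩, hπ.eq_of_not_lt fun hlt => ?_⟩
  have h1 : P.valuation (T / π ^ k) < 1 := by
    rw [map_div₀, map_pow]
    exact (div_lt_one₀ (pow_pos hv0 k)).2 hlt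
  have h2 := hunif _ h1
  rw [map_div₀, map_pow, div_le_iff₀ (pow_pos hv0 k), ← pow_succ'] at h2
  have := hmax (k + 1) ⟨π, hπ1, h2⟩
  omega

end PVal

/-! ### The set of `p`-valuations above `𝔭` -/

section PrimesAbove

variable {K : Type u} [Field K] {F : Type w} [Field F] [Algebra K F]

theorem valuation_restrictTo_le_iff (P : ValuationSubring F) (x y : K) :
    (restrictTo K P).valuation x ≤ (restrictTo K P).valuation y ↔
      P.valuation (algebraMap K F x) ≤ P.valuation (algebraMap K F y) := by
  rw [ValuationSubring.valuation_le_iff]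
  constructor
  · rintro ⟨a, rfl⟩
    rw [map_mul, map_mul]
    exact mul_le_of_le_one_left zero_le ((P.valuation_le_one_iff _).2 a.2)
  · intro h
    by_cases hy : y = 0
    · subst hy
      rw [map_zero, map_zero, le_zero_iff, map_eq_zero, map_eq_zero] at h
      exact ⟨0, by simp [h]⟩
    · refine ⟨⟨x / y, ?_⟩, div_mul_cancel₀ x hy⟩
      rw [ValuationSubring.mem_comap, ← P.valuation_le_one_iff, map_div₀, map_div₀]
      refine div_le_one_of_le₀ h zero_le

theorem valuation_restrictTo_lt_iff (P : ValuationSubring F) (x y : K) :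
    (restrictTo K P).valuation x < (restrictTo K P).valuation y ↔
      P.valuation (algebraMap K F x) < P.valuation (algebraMap K F y) := by
  rw [← not_le, valuation_restrictTo_le_iff, not_le]

theorem valuation_restrictTo_lt_one_iff (P : ValuationSubring F) (x : K) :
    (restrictTo K P).valuation x < 1 ↔ P.valuation (algebraMap K F x) < 1 := by
  simpa using valuation_restrictTo_lt_iff P x 1

/-- The value of any uniformizer of the restriction of `P` determines the initial ramification. -/
theorem IsRelInitialRamification.exists_uniformizer {P : ValuationSubring F} {e' : ℕ}
    (h : IsRelInitialRamification K P e') {t : K} (ht : IsUniformizerOf (restrictTo K P) t) :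
    ∃ π : F, IsUniformizerOf P π ∧ P.valuation (algebraMap K F t) = P.valuation π ^ e' := by
  obtain ⟨t', π, ht', hπ, h⟩ := h
  refine ⟨π, hπ, ?_⟩
  rw [← h]
  exact le_antisymm ((valuation_restrictTo_le_iff P _ _).1 (ht'.2.2 t ht.2.1))
    ((valuation_restrictTo_le_iff P _ _).1 (ht.2.2 t' ht'.2.1))

/-- A description of `𝒮_𝔭^τ(F)` by conditions which are preserved under limits. -/
theorem mem_primesAbove_iff {𝔭 : ValuationSubring K} (h𝔭 : IsPValuation 𝔭) {t : K}
    (ht : IsUniformizerOf 𝔭 t) {e f : ℕ} (hf : 0 < f) (P : ValuationSubring F) :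
    P ∈ primesAbove 𝔭 e f F ↔ restrictTo K P = 𝔭 ∧
      (∀ x : F, P.valuation x < 1 → P.valuation x ^ e ≤ P.valuation (algebraMap K F t)) ∧
      ∀ u ∈ P, P.valuation (u ^ Nat.card (IsLocalRing.ResidueField 𝔭) ^ f - u) < 1 := by
  obtain ⟨p, h𝔭⟩ := h𝔭
  constructor
  · rintro ⟨-, rfl, ⟨e', he', hle⟩, hdvd⟩
    have := h𝔭.finite_residueField
    refine ⟨rfl, fun x hx => ?_, (relResidueDegree_dvd_iff P K hf).1 hdvd⟩
    obtain ⟨π, hπ, h⟩ := he'.exists_uniformizer ht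
    rw [h]
    exact (pow_le_pow_right_of_le_one' hx.le hle).trans (pow_le_pow_left' (hπ.2.2 x hx) e')
  · rintro ⟨rfl, hram, hres⟩
    have := h𝔭.finite_residueField
    have hdvd := (relResidueDegree_dvd_iff P K hf).2 hres
    have ht0 : algebraMap K F t ≠ 0 := by simpa using ht.1
    have ht1 := (valuation_restrictTo_lt_one_iff P t).1 ht.2.1
    obtain ⟨k, π, hk, hπ, hkπ⟩ := exists_isUniformizerOf ht0 ht1 hram
    refine ⟨⟨p, ?_⟩, rfl, ⟨k, ⟨t, π, ht, hπ, hkπ⟩, hk⟩, hdvd⟩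
    obtain ⟨m, hm⟩ := h𝔭.exists_pow_dvd ht.2.1
    rw [← map_pow, valuation_restrictTo_le_iff, map_pow, map_pow, hkπ, ← pow_mul,
      map_natCast] at hm
    have hp1 := h𝔭.residueChar
    rw [ValuationSubring.valuation_lt_one_iff, valuation_restrictTo_lt_one_iff] at hp1
    have : CharZero K := h𝔭.charZero
    have : CharZero F := charZero_of_injective_algebraMap (algebraMap K F).injective
    have : Finite (IsLocalRing.ResidueField P) := by
      let _ : Algebra (IsLocalRing.ResidueField (restrictTo K P)) (IsLocalRing.ResidueField P) :=
        (IsLocalRing.ResidueField.map (restrictToHom K P)).toAlgebra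
      have : Module.Finite (IsLocalRing.ResidueField (restrictTo K P))
          (IsLocalRing.ResidueField P) :=
        -- An infinite extension would have `finrank` 0, which does not divide f > 0.
        Module.finite_of_finrank_pos (Nat.pos_of_dvd_of_pos hdvd hf)
      exact Module.finite_of_finite (IsLocalRing.ResidueField (restrictTo K P))
    exact IsPValuationAt.of_uniformizer h𝔭.prime (by simpa using hp1) hπ hm

end PrimesAbove

/-! ### Limits of valuation rings -/

section Limits

variable {F : Type w} [Field F]

/-- The limit of the valuation rings of a field along an ultrafilter. -/
def limitValuationSubring (U : Ultrafilter (ValuationSubring F)) : ValuationSubring F where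
  carrier := {x | ∀ᶠ P : ValuationSubring F in U, x ∈ P}
  mul_mem' hx hy := (Filter.Eventually.and hx hy).mono fun _ h => mul_mem h.1 h.2
  one_mem' := Filter.Eventually.of_forall fun P => one_mem P
  add_mem' hx hy := (Filter.Eventually.and hx hy).mono fun _ h => add_mem h.1 h.2
  zero_mem' := Filter.Eventually.of_forall fun P => zero_mem P
  neg_mem' hx := Filter.Eventually.mono hx fun _ h => neg_mem h
  mem_or_inv_mem' x := Ultrafilter.eventually_or.1 <|
    Filter.Eventually.of_forall fun P : ValuationSubring F => P.mem_or_inv_mem x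

variable (U : Ultrafilter (ValuationSubring F))

theorem mem_limitValuationSubring (x : F) :
    x ∈ limitValuationSubring U ↔ ∀ᶠ P : ValuationSubring F in U, x ∈ P := Iff.rfl

/-- Being a nonunit is a Boolean combination of membership conditions, and ultrafilters commute with
these. -/
theorem limitValuationSubring_valuation_lt_one_iff (x : F) :
    (limitValuationSubring U).valuation x < 1 ↔ ∀ᶠ P : ValuationSubring F in U, P.valuation x < 1 := by
  simp_rw [← ValuationSubring.mem_nonunits_iff, ValuationSubring.mem_nonunits_iff_or,
    Ultrafilter.eventually_or, Ultrafilter.eventually_not, mem_limitValuationSubring,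
    Filter.eventually_const]

theorem limitValuationSubring_valuation_le_iff (x y : F) :
    (limitValuationSubring U).valuation x ≤ (limitValuationSubring U).valuation y ↔
      ∀ᶠ P : ValuationSubring F in U, P.valuation x ≤ P.valuation y := by
  have key : ∀ P : ValuationSubring F,
      P.valuation x ≤ P.valuation y ↔ x = 0 ∨ (y ≠ 0 ∧ x / y ∈ P) := by
    intro P
    by_cases hx : x = 0
    · simp [hx]
    · by_cases hy : y = 0
      · simp [hx, hy]
      · have : 0 < P.valuation y := by simpa [zero_lt_iff] using hy
        rw [← P.valuation_le_one_iff, map_div₀, div_le_one₀ this]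
        simp [hx, hy]
  simp_rw [key, Ultrafilter.eventually_or, mem_limitValuationSubring, Filter.eventually_and,
    Filter.eventually_const]

/-- Compactness of `primesAbove`: the conditions of `mem_primesAbove_iff` concern fixed elements of
F one at a time, so each passes to the limit. -/
theorem limitValuationSubring_mem_primesAbove {K : Type u} [Field K] [Algebra K F]
    {𝔭 : ValuationSubring K} (h𝔭 : IsPValuation 𝔭) {t : K} (ht : IsUniformizerOf 𝔭 t)
    {e f : ℕ} (hf : 0 < f) (hU : ∀ᶠ P : ValuationSubring F in U, P ∈ primesAbove 𝔭 e f F) :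
    limitValuationSubring U ∈ primesAbove 𝔭 e f F := by
  simp_rw [mem_primesAbove_iff h𝔭 ht hf] at hU ⊢
  refine ⟨ValuationSubring.ext _ _ fun x => ?_, fun x hx => ?_, fun u hu => ?_⟩
  · rw [ValuationSubring.mem_comap, mem_limitValuationSubring]
    have h1 : ∀ᶠ P : ValuationSubring F in U, (algebraMap K F x ∈ P ↔ x ∈ 𝔭) := by
      filter_upwards [hU] with P hP
      rw [← hP.1, ValuationSubring.mem_comap]
    rw [Filter.eventually_congr h1, Filter.eventually_const]
  · rw [limitValuationSubring_valuation_lt_one_iff] at hx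
    rw [← map_pow, limitValuationSubring_valuation_le_iff]
    filter_upwards [hU, hx] with P hP hx
    rw [map_pow]
    exact hP.2.1 x hx
  · rw [mem_limitValuationSubring] at hu
    rw [limitValuationSubring_valuation_lt_one_iff]
    filter_upwards [hU, hu] with P hP hu using hP.2.2 u hu

/-- If each limit of elements of `S` lies in one of the sets `{P | x y ∈ P ∧ x' y ∈ P}`, then
finitely many of these sets cover `S`. -/
theorem exists_finset_cover {ι : Type*} (S : Set (ValuationSubring F)) (a b : ι → F)
    (h : ∀ U : Ultrafilter (ValuationSubring F), S ∈ U →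
      ∃ i, a i ∈ limitValuationSubring U ∧ b i ∈ limitValuationSubring U) :
    ∃ Y : Finset ι, ∀ P ∈ S, ∃ i ∈ Y, a i ∈ P ∧ b i ∈ P := by
  classical
  by_contra! hcon
  let C : Finset ι → Set (ValuationSubring F) := fun Y =>
    {P | P ∈ S ∧ ∀ i ∈ Y, a i ∈ P → b i ∉ P}
  let _ : Nonempty (Finset ι) := ⟨∅⟩
  -- If no finite set of indices covers `S`, the sets `C Y` are nonempty and directed; an
  -- ultrafilter containing them all has a limit that contradicts `h`.
  have hdir : Directed (· ≥ ·) fun Y => Filter.principal (C Y) := fun Y Z =>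
    ⟨Y ∪ Z,
      Filter.principal_mono.2 fun P hP => ⟨hP.1, fun i hi => hP.2 i (Finset.mem_union_left _ hi)⟩,
      Filter.principal_mono.2 fun P hP => ⟨hP.1, fun i hi => hP.2 i (Finset.mem_union_right _ hi)⟩⟩
  have hne : (⨅ Y, Filter.principal (C Y)).NeBot :=
    Filter.iInf_neBot_of_directed' hdir fun Y => Filter.principal_neBot_iff.2 (hcon Y)
  obtain ⟨U, hU⟩ := Ultrafilter.exists_le (⨅ Y, Filter.principal (C Y))
  have hUC : ∀ Y, C Y ∈ U := fun Y => hU (Filter.mem_iInf_of_mem Y (Filter.mem_principal_self _))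
  obtain ⟨i, h1, h2⟩ := h U (Filter.mem_of_superset (hUC ∅) fun P hP => hP.1)
  obtain ⟨P, ⟨h1, h2⟩, hP⟩ := ((Filter.Eventually.and h1 h2).and (hUC {i})).exists
  exact hP.2 i (Finset.mem_singleton_self i) h1 h2

end Limits

/-! ### Approximate roots -/

section ApproxRoot

variable {K : Type u} [Field K] {F : Type w} [Field F] [Algebra K F]

theorem mem_holomorphyDomain {𝔭 : ValuationSubring K} {e f : ℕ} {x : F} :
    x ∈ holomorphyDomain 𝔭 e f F ↔ ∀ P ∈ primesAbove 𝔭 e f F, x ∈ P := by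
  simp [holomorphyDomain]

theorem approx_iff_mem (P : ValuationSubring F) (n : ℕ) (x y s : Fˣ) :
    (0 ≤ n • addVal P y - addVal P x ∧ n • addVal P y - addVal P x ≤ n • addVal P s) ↔
      ((y ^ n / x : Fˣ) : F) ∈ P ∧ ((s ^ n / (y ^ n / x) : Fˣ) : F) ∈ P := by
  rw [← addVal_nonneg_iff, ← addVal_nonneg_iff, addVal_div _ (s ^ n), addVal_div, addVal_pow,
    addVal_pow, sub_nonneg (a := n • addVal P s)]

theorem exists_approxRoot_of_isOrderedZGroup {𝔭 : ValuationSubring K} (h𝔭 : IsPValuation 𝔭)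
    {t : K} (ht : IsUniformizerOf 𝔭 t) {e f : ℕ} (hf : 0 < f)
    (hZ : ∀ P ∈ primesAbove 𝔭 e f F, IsOrderedZGroup (AddValueGroup P)) {n : ℕ} (hn : 0 < n)
    (x s : Fˣ) (hs : (s : F) = algebraMap K F t) :
    ∃ y : Fˣ, ∀ P ∈ primesAbove 𝔭 e f F,
      0 ≤ n • addVal P y - addVal P x ∧ n • addVal P y - addVal P x ≤ n • addVal P s := by
  obtain ⟨Y, hY⟩ := exists_finset_cover (primesAbove 𝔭 e f F)
    (fun y : Fˣ => ((y ^ n / x : Fˣ) : F)) (fun y : Fˣ => ((s ^ n / (y ^ n / x) : Fˣ) : F))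
    (fun U hU => by
      have hP := limitValuationSubring_mem_primesAbove U h𝔭 ht hf hU
      -- The limit is again in `primesAbove`, so its value group is a ℤ-group and supplies a
      -- candidate there.
      have hs0 : 0 < addVal (limitValuationSubring U) s := by
        rw [addVal_pos_iff, hs, ← valuation_restrictTo_lt_one_iff, hP.2.1]
        exact ht.2.1
      obtain ⟨k, hk⟩ := (hZ _ hP).exists_approx hs0 hn (addVal _ x)
      obtain ⟨y, rfl⟩ := addVal_surjective _ k
      exact ⟨y, (approx_iff_mem _ n x y s).1 hk⟩)
  obtain ⟨p, h⟩ := id h𝔭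
  have := h.finite_residueField
  obtain ⟨z, hz⟩ := exists_glued_approxRoot (primesAbove 𝔭 e f F)
    (Nat.one_lt_pow hf.ne' (Finite.one_lt_card (α := IsLocalRing.ResidueField 𝔭)))
    (fun P hP => ((mem_primesAbove_iff h𝔭 ht hf P).1 hP).2.2) hn x s Y
  refine ⟨z, fun P hP => ⟨(hz P hP).1, ?_⟩⟩
  obtain ⟨y, hy, h⟩ := hY P hP
  obtain ⟨h0, h1⟩ := (approx_iff_mem _ n x y s).2 h
  exact (hz P hP).2 y hy h0 h1

theorem isOrderedZGroup_of_exists_approxRoot {𝔭 : ValuationSubring K} {t : K}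
    (ht : IsUniformizerOf 𝔭 t) {e f : ℕ} {P : ValuationSubring F} (hP : P ∈ primesAbove 𝔭 e f F) (s : Fˣ) (hs : (s : F) = algebraMap K F t)
    (h : ∀ n : ℕ, 0 < n → ∀ x : Fˣ, ∃ y : Fˣ,
      0 ≤ n • addVal P y - addVal P x ∧ n • addVal P y - addVal P x ≤ n • addVal P s) :
    IsOrderedZGroup (AddValueGroup P) := by
  obtain ⟨-, rfl, ⟨e', he', -⟩, -⟩ := hP
  obtain ⟨π, hπ, hπt⟩ := he'.exists_uniformizer ht
  have hs' : addVal P s = e' • addVal P (Units.mk0 π hπ.1) := by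
    rw [← addVal_pow, addVal_eq_iff, hs, hπt, Units.val_pow_eq_pow_val, Units.val_mk0, map_pow]
  refine IsOrderedZGroup.of_approx (u := addVal P (Units.mk0 π hπ.1))
    ((addVal_pos_iff _ _).2 hπ.2.1) (fun g hg => ?_) e' fun n hn g => ?_
  · obtain ⟨x, rfl⟩ := addVal_surjective P g
    exact (addVal_le_iff _ _ _).2 (hπ.2.2 x ((addVal_pos_iff _ _).1 hg))
  · obtain ⟨x, rfl⟩ := addVal_surjective P g
    obtain ⟨y, hy⟩ := h n hn x
    exact ⟨addVal P y, by rwa [hs'] at hy⟩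

theorem isModelOf_approxRootSentence_iff {𝔭 : ValuationSubring K} (h𝔭 : IsPValuation 𝔭)
    {t : K} (ht : IsUniformizerOf 𝔭 t) {e f : ℕ} (hf : 0 < f) :
    IsModelOf K (holomorphyDomain 𝔭 e f F) (Set.range (approxRootSentence t)) ↔
      ∀ P ∈ primesAbove 𝔭 e f F, IsOrderedZGroup (AddValueGroup P) := by
  have hs0 : algebraMap K F t ≠ 0 := by simpa using ht.1
  set s : Fˣ := Units.mk0 _ hs0 with hs
  rw [isModelOf_range_approxRootSentence]
  constructor
  · intro h P hP
    refine isOrderedZGroup_of_exists_approxRoot ht hP s rfl fun n hn x => ?_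
    obtain ⟨n, rfl⟩ := Nat.exists_eq_succ_of_ne_zero hn.ne'
    obtain ⟨y, a, b, ⟨ha, hb⟩, hax, hby⟩ := h n x
    -- The second equation excludes y = 0, as t and x are nonzero.
    have hy0 : y ≠ 0 := by
      rintro rfl
      rw [zero_pow n.succ_ne_zero, zero_mul, eq_comm] at hby
      exact mul_ne_zero (pow_ne_zero _ hs0) x.ne_zero hby
    refine ⟨Units.mk0 y hy0, (approx_iff_mem _ _ _ _ _).2 ?_⟩
    have ha' : a = ((Units.mk0 y hy0 ^ (n + 1) / x : Fˣ) : F) := by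
      rw [Units.val_div_eq_div_val, Units.val_pow_eq_pow_val, Units.val_mk0, ← hax,
        mul_div_cancel_right₀ _ x.ne_zero]
    have hb' : b = ((s ^ (n + 1) / (Units.mk0 y hy0 ^ (n + 1) / x) : Fˣ) : F) := by
      simp only [Units.val_div_eq_div_val, Units.val_pow_eq_pow_val, Units.val_mk0, hs]
      rw [div_div_eq_mul_div, ← hby, mul_div_cancel_left₀ _ (pow_ne_zero _ hy0)]
    rw [mem_holomorphyDomain] at ha hb
    exact ⟨ha' ▸ ha P hP, hb' ▸ hb P hP⟩
  · intro hZ n x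
    by_cases hx : x = 0
    · have h0 : (0 : F) ∈ holomorphyDomain 𝔭 e f F :=
        mem_holomorphyDomain.2 fun P _ => zero_mem P
      exact ⟨0, 0, 0, ⟨h0, h0⟩, by simp, by simp [hx]⟩
    · obtain ⟨y, hy⟩ := exists_approxRoot_of_isOrderedZGroup h𝔭 ht hf hZ n.succ_pos
        (Units.mk0 x hx) s rfl
      have hy' := fun P hP => (approx_iff_mem _ _ _ _ _).1 (hy P hP)
      refine ⟨y, _, _, ⟨mem_holomorphyDomain.2 fun P hP => (hy' P hP).1,
        mem_holomorphyDomain.2 fun P hP => (hy' P hP).2⟩, ?_, ?_⟩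
      · simp [div_mul_cancel₀ _ hx]
      · have : (y : F) ≠ 0 := y.ne_zero
        simp only [Units.val_div_eq_div_val, Units.val_pow_eq_pow_val, Units.val_mk0, hs,
          Nat.succ_eq_add_one]
        field_simp

end ApproxRoot

theorem mainTheorem12 (K : Type u) [Field K] [NumberField K]
    (𝔭 : ValuationSubring K) (h𝔭 : IsPValuation 𝔭)
    (e f : ℕ) (he : 0 < e) (hf : 0 < f) :
    ∃ T : (ringPredLanguageOver K).Theory,
      ∀ (F : Type w) [Field F] [Algebra K F],
        IsModelOf K (holomorphyDomain 𝔭 e f F) T ↔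
          primesAbove 𝔭 e f F = primesAboveZ 𝔭 e f F := by
  have key : ∀ (F : Type w) [Field F] [Algebra K F],
      primesAbove 𝔭 e f F = primesAboveZ 𝔭 e f F ↔
        ∀ P ∈ primesAbove 𝔭 e f F, IsOrderedZGroup (AddValueGroup P) := fun F _ _ =>
    ⟨fun h P hP => (h ▸ hP : P ∈ primesAboveZ 𝔭 e f F).2,
      fun h => Set.Subset.antisymm (fun P hP => ⟨hP, h P hP⟩) fun P hP => hP.1⟩
  by_cases ht : ∃ t : K, IsUniformizerOf 𝔭 t
  · obtain ⟨t, ht⟩ := ht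
    exact ⟨Set.range (approxRootSentence t), fun F _ _ => by
      rw [key, isModelOf_approxRootSentence_iff h𝔭 ht hf]⟩
  -- Relative ramification presupposes a uniformizer of `𝔭`; without one `primesAbove` is empty and
  -- the empty theory serves.
  · refine ⟨∅, fun F _ _ => ?_⟩
    rw [key]
    refine iff_of_true (by simp [IsModelOf, Theory.model_iff]) ?_
    rintro P ⟨-, rfl, ⟨e', ⟨t, π, ht', -⟩, -⟩, -⟩
    exact absurd ⟨t, ht'⟩ ht
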